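/- Fix $N\ge 1$, $K\in\mathbb N$ and $\mathbf x^\star\in\mathbb R^K$. At each time $t=1,2,\dots$ one observes $\mathbf g_n^{(t)}\in\mathbb R^K$ and $y_n^{(t)}=(\mathbf g_n^{(t)})^T\mathbf x^\star+v_n^{(t)}$, $n=1,\dots,N$, where the tuples $(\mathbf g_n^{(t)},v_n^{(t)})_{n=1}^N$, $t\ge 1$, are independent and identically distributed. Assume: (A1) for each $t$, the vectors $\mathbf g_n^{(t)}$, $n=1,\dots,N$, are i.i.d. with a finite positive definite covariance matrix; (A2) for each $t$, the variables $v_n^{(t)}$, $n=1,\dots,N$, are i.i.d. with zero mean and finite variance, and $v_n^{(t)}$ is uncorrelated with $\mathbf g_n^{(t)}$; (A3) $\mu^{(t)}>0$ and $\mu^{(t)}\to 0$; (A4) all moments of $\mathbf g_n^{(t)}$ and $v_n^{(t)}$ are finite; (A5) the proximal weights $c_k^{(t)}\ge 0$ (which may be random) satisfy: almost surely there are constants $c>0$ and $C<\infty$ with $G_{kk}^{(t)}+c_k^{(t)}\ge c$ and $c_k^{(t)}\le C$ for all $t\ge1$ and all $k$; (A6) $\mu^{(t)}\ge\mu^{(t+1)}$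 for all $t$. Here $\mathbf G^{(t)}=\frac1t\sum_{\tau=1}^t\sum_{n=1}^N\mathbf g_n^{(\tau)}(\mathbf g_n^{(\tau)})^T$, $\mathbf b^{(t)}=\frac1t\sum_{\tau=1}^t\sum_{n=1}^N y_n^{(\tau)}\mathbf g_n^{(\tau)}$, and $L^{(t)}(\mathbf x)=\frac12\mathbf x^T\mathbf G^{(t)}\mathbf x-(\mathbf b^{(t)})^T\mathbf x+\mu^{(t)}\|\mathbf x\|_1$. The online parallel algorithm starts from an arbitrary $\mathbf x^{(1)}\in\mathbb R^K$ and, for $t=1,2,\dots$, computes 1. the best response $\hat x_k^{(t)}=\dfrac{\mathcal S_{\mu^{(t)}}\bigl(r_k^{(t)}+c_k^{(t)}x_k^{(t)}\bigr)}{G_{kk}^{(t)}+c_k^{(t)}}$ for all $k$, where $r_k^{(t)}=b_k^{(t)}-\sum_{j\ne k}G_{kj}^{(t)}x_j^{(t)}$ and $\mathcal S_a(b)=\max(b-a,0)-\max(-b-a,0)$; 2. with $\mathbf d=\hat{\mathbf x}^{(t)}-\mathbf x^{(t)}$, the stepsize $\gamma^{(t)}\in[0,1]$ that minimizes $\frac12\mathbf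 d^T\mathbf G^{(t)}\mathbf d\,\gamma^2+\bigl[(\mathbf G^{(t)}\mathbf x^{(t)}-\mathbf b^{(t)})^T\mathbf d+\mu^{(t)}(\|\hat{\mathbf x}^{(t)}\|_1-\|\mathbf x^{(t)}\|_1)\bigr]\gamma$ over $\gamma\in[0,1]$ ($\gamma^{(t)}=0$ if this function vanishes identically); 3. $\tilde{\mathbf x}^{(t)}=\mathbf x^{(t)}+\gamma^{(t)}\mathbf d$, and $\mathbf x^{(t+1)}=\tilde{\mathbf x}^{(t)}$ if $L^{(t)}(\tilde{\mathbf x}^{(t)})\le 0$, $\mathbf x^{(t+1)}=\mathbf 0$ otherwise. Then $\lim_{t\to\infty}\mathbf x^{(t)}=\mathbf x^\star$ with probability 1. -/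

import Mathlib

open MeasureTheory ProbabilityTheory Filter Topology

namespace OnlineParallel

noncomputable section

/-! Time is indexed from `0`: the index `s` stands for the time instance `t = s + 1`.  Thus
`g s n`, `y s n` are the regression vector and the `n`-th measurement received at time `s + 1`,
`μ s` and `c s` are the regularization and proximal weights used at time `s + 1`, and
`iterate … s` is the estimate available before the samples of time `s + 1` arrive. -/

/-- The linear regression model `y_n = g_nᵀ x⋆ + v_n`. -/
def measurement {N K : ℕ} (xstar : Fin K → ℝ) (g : ℕ → Fin N → Fin K → ℝ)
    (v : ℕ → Fin N → ℝ) (s : ℕ) (n : Fin N) : ℝ :=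
  g s n ⬝ᵥ xstar + v s n

/-- The sample average `(1/t) ∑_{τ ≤ t} ∑_n g_n^{(τ)} (g_n^{(τ)})ᵀ`, with `t = s + 1`. -/
def sampleGram {N K : ℕ} (g : ℕ → Fin N → Fin K → ℝ) (s : ℕ) : Matrix (Fin K) (Fin K) ℝ :=
  ((s : ℝ) + 1)⁻¹ • ∑ τ ∈ Finset.range (s + 1), ∑ n : Fin N, Matrix.vecMulVec (g τ n) (g τ n)

/-- The sample average `(1/t) ∑_{τ ≤ t} ∑_n y_n^{(τ)} g_n^{(τ)}`, with `t = s + 1`. -/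
def sampleCross {N K : ℕ} (g : ℕ → Fin N → Fin K → ℝ) (y : ℕ → Fin N → ℝ) (s : ℕ) :
    Fin K → ℝ :=
  ((s : ℝ) + 1)⁻¹ • ∑ τ ∈ Finset.range (s + 1), ∑ n : Fin N, y τ n • g τ n

/-- The `ℓ₁`-norm. -/
def l1norm {K : ℕ} (x : Fin K → ℝ) : ℝ := ∑ k, |x k|

/-- The `ℓ₁`-regularized quadratic function `½ xᵀ G x - bᵀ x + μ ‖x‖₁`. -/
def lassoObjective {K : ℕ} (G : Matrix (Fin K) (Fin K) ℝ) (b : Fin K → ℝ) (μ : ℝ)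
    (x : Fin K → ℝ) : ℝ :=
  1 / 2 * (x ⬝ᵥ G.mulVec x) - b ⬝ᵥ x + μ * l1norm x

/-- The soft-thresholding operator `S_a(b) = (b - a)⁺ - (-b - a)⁺`. -/
def softThreshold (a b : ℝ) : ℝ := max (b - a) 0 - max (-b - a) 0

/-- `r_k = b_k - ∑_{j ≠ k} G_{kj} x_j`. -/
def partialResidual {K : ℕ} (G : Matrix (Fin K) (Fin K) ℝ) (b x : Fin K → ℝ) (k : Fin K) : ℝ :=
  b k - ∑ j ∈ Finset.univ.erase k, G k j * x j

/-- The best response `S_μ(r_k + c_k x_k) / (G_{kk} + c_k)`, computed for all `k` in parallel;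
for `G_{kk} + c_k > 0` it is the minimizer over `z` of the `ℓ₁`-regularized function with the
`k`-th coordinate of `x` replaced by `z`, plus `½ c_k (z - x_k)²`. -/
def bestResponse {K : ℕ} (G : Matrix (Fin K) (Fin K) ℝ) (b : Fin K → ℝ) (μ : ℝ)
    (c x : Fin K → ℝ) (k : Fin K) : ℝ :=
  softThreshold μ (partialResidual G b x k + c k * x k) / (G k k + c k)

/-- The minimizer of `½ a γ² + β γ` over `γ ∈ [0, 1]`, for `a ≥ 0`: the projection of `-β / a`
onto `[0, 1]` if `a ≠ 0`; if `a = 0` the function is linear and the minimizer is an end point. -/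
def clippedMinimizer (a β : ℝ) : ℝ :=
  if a = 0 then (if β < 0 then 1 else 0) else min (max (-β / a) 0) 1

/-- The stepsize of the simplified minimization rule at `x` with best response `xhat`: the
minimizer over `γ ∈ [0, 1]` of
`½ dᵀ G d γ² + (G x - b)ᵀ d γ + μ (‖xhat‖₁ - ‖x‖₁) γ`, where `d = xhat - x`. -/
def stepsize {K : ℕ} (G : Matrix (Fin K) (Fin K) ℝ) (b : Fin K → ℝ) (μ : ℝ)
    (x xhat : Fin K → ℝ) : ℝ :=
  clippedMinimizer ((xhat - x) ⬝ᵥ G.mulVec (xhat - x))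
    ((G.mulVec x - b) ⬝ᵥ (xhat - x) + μ * (l1norm xhat - l1norm x))

/-- The intermediate update `x + γ (xhat - x)`. -/
def intermediate {K : ℕ} (G : Matrix (Fin K) (Fin K) ℝ) (b : Fin K → ℝ) (μ : ℝ)
    (c x : Fin K → ℝ) : Fin K → ℝ :=
  x + stepsize G b μ x (bestResponse G b μ c x) • (bestResponse G b μ c x - x)

/-- The next estimate: the intermediate update, reset to `0` if its objective value is
positive. -/
def nextEstimate {K : ℕ} (G : Matrix (Fin K) (Fin K) ℝ) (b : Fin K → ℝ) (μ : ℝ)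
    (c x : Fin K → ℝ) : Fin K → ℝ :=
  if lassoObjective G b μ (intermediate G b μ c x) ≤ 0 then intermediate G b μ c x else 0

/-- The estimates produced by the online parallel algorithm from the data `g`, `y`, the weights
`μ`, `c` and the initial point `x1`. -/
def iterate {N K : ℕ} (g : ℕ → Fin N → Fin K → ℝ) (y : ℕ → Fin N → ℝ) (μ : ℕ → ℝ)
    (c : ℕ → Fin K → ℝ) (x1 : Fin K → ℝ) : ℕ → Fin K → ℝ
  | 0 => x1
  | s + 1 => nextEstimate (sampleGram g s) (sampleCross g y s) (μ s) (c s)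
      (iterate g y μ c x1 s)

end

end OnlineParallel

/-!
The proof separates the randomness from the dynamics.

*Randomness.* By the strong law of large numbers the matrices `sampleGram` converge almost surely to
`Ginf = ∑ n, E[g_n g_nᵀ]` (`ae_tendsto_sampleGram`), which is positive definite, being a sum of
positive definite covariance matrices and of rank one matrices of means (`momentMatrix_posDef`).
The averaged products of noise and regressors tend to `0` because the two are uncorrelated
(`ae_tendsto_sampleCross_noise`), so `sampleCross` converges to `Ginf x⋆`.

*Dynamics.* On this event the algorithm is a deterministic recursion (`tendsto_of_tendsto_data`).
Two facts about one step drive it. The best response is a descent direction whose slope is at most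
`-c₀ ‖d‖²` for the displacement `d`, so the exact line search lowers the empirical objective by a
multiple of `‖d‖²` (`lassoObjective_intermediate_le`), and the reset can only lower it further
(`lassoObjective_nextEstimate_le`). Conversely a small displacement means a small residual of the
normal equations (`norm_residual_le`). Since after one step the objective is nonpositive, the
estimates stay in a ball (`norm_le_of_lassoObjective_nonpos`), on which the empirical objectives and
their gradients converge uniformly to those of the limit objective. Therefore the gap
`V = ½ (x - x⋆)ᵀ Ginf (x - x⋆)` satisfies `V⁺ ≤ (1 - ρ) V + o(1)` with a fixed `ρ > 0`, which forces
`V → 0` (`tendsto_zero_of_le_sub_mul_add`). No rate of convergence of the averages is needed.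
-/

namespace OnlineParallel

/-! ### Scalar facts: soft-thresholding, the line search, a perturbed contraction -/

lemma abs_softThreshold_sub_le {a : ℝ} (ha : 0 ≤ a) (b : ℝ) : |softThreshold a b - b| ≤ a := by
  unfold softThreshold
  rw [abs_le]
  rcases max_cases (b - a) 0 with h | h <;> rcases max_cases (-b - a) 0 with h' | h' <;>
    constructor <;> linarith

/-- The variational inequality of the soft-thresholded minimizer `z = S_a(u) / h` of
`½ h z² - u z + a |z|`. -/
lemma softThreshold_div_variational {a h : ℝ} (ha : 0 ≤ a) (hh : 0 < h) (u x : ℝ) :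
    (h * (softThreshold a u / h) - u) * (softThreshold a u / h - x)
      + a * (|softThreshold a u / h| - |x|) ≤ 0 := by
  set z := softThreshold a u / h with hz
  have hmul : h * z = softThreshold a u := by rw [hz]; field_simp
  have hx1 := le_abs_self x
  have hx2 := neg_abs_le x
  have hzh : z = h⁻¹ * softThreshold a u := by rw [hz]; field_simp
  have hinv : 0 < h⁻¹ := inv_pos.mpr hh
  rw [hmul]
  unfold softThreshold at *
  rcases le_total u (-a) with h1 | h1
  · have e : max (u - a) 0 - max (-u - a) 0 = u + a := by
      rw [max_eq_right (by linarith), max_eq_left (by linarith)]; ring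
    rw [e] at hzh ⊢
    have : z ≤ 0 := by rw [hzh]; exact mul_nonpos_of_nonneg_of_nonpos hinv.le (by linarith)
    rw [abs_of_nonpos this]
    nlinarith
  · rcases le_total u a with h2 | h2
    · have e : max (u - a) 0 - max (-u - a) 0 = 0 := by
        rw [max_eq_right (by linarith), max_eq_right (by linarith)]; ring
      rw [e] at hzh ⊢
      have : z = 0 := by rw [hzh]; ring
      rw [this, abs_zero]
      have : u * x ≤ a * |x| := by
        calc u * x ≤ |u * x| := le_abs_self _
          _ = |u| * |x| := abs_mul _ _
          _ ≤ a * |x| := mul_le_mul_of_nonneg_right (abs_le.mpr ⟨by linarith, h2⟩) (abs_nonneg _)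
      linarith
    · have e : max (u - a) 0 - max (-u - a) 0 = u - a := by
        rw [max_eq_left (by linarith), max_eq_right (by linarith)]; ring
      rw [e] at hzh ⊢
      have : 0 ≤ z := by rw [hzh]; exact mul_nonneg hinv.le (by linarith)
      rw [abs_of_nonneg this]
      nlinarith

lemma clippedMinimizer_mem (a β : ℝ) : clippedMinimizer a β ∈ Set.Icc (0 : ℝ) 1 := by
  unfold clippedMinimizer
  split_ifs <;> simp

/-- The clipped stationary point does minimize the quadratic over `[0, 1]`. -/
lemma clippedMinimizer_le {a : ℝ} (ha : 0 ≤ a) (β : ℝ) {γ : ℝ} (h0 : 0 ≤ γ) (h1 : γ ≤ 1) :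
    1 / 2 * a * clippedMinimizer a β ^ 2 + β * clippedMinimizer a β
      ≤ 1 / 2 * a * γ ^ 2 + β * γ := by
  unfold clippedMinimizer
  split_ifs with h h'
  · subst h; nlinarith
  · subst h; nlinarith
  · have hp : 0 < a := lt_of_le_of_ne ha (Ne.symm h)
    obtain ⟨w, hw⟩ : ∃ w, w = -β / a := ⟨_, rfl⟩
    have hβ : β = -(a * w) := by rw [hw]; field_simp
    rw [← hw, hβ]
    -- up to a constant the quadratic is `½ a (γ - w)²`
    suffices hs : (min (max w 0) 1 - w) ^ 2 ≤ (γ - w) ^ 2 by nlinarith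
    rcases le_total w 0 with hw0 | hw0
    · rw [max_eq_right hw0, min_eq_left zero_le_one]; nlinarith
    · rw [max_eq_left hw0]
      rcases le_total w 1 with hw1 | hw1
      · rw [min_eq_left hw1]; nlinarith [sq_nonneg (γ - w)]
      · rw [min_eq_right hw1]; nlinarith

/-- A contraction perturbed by vanishing errors converges to `0`. -/
lemma tendsto_zero_of_le_sub_mul_add {V ε : ℕ → ℝ} {ρ : ℝ} (hρ : 0 < ρ) (hV : ∀ t, 0 ≤ V t)
    (hε : Tendsto ε atTop (𝓝 0))
    (hrec : ∀ᶠ t in atTop, V (t + 1) ≤ V t - ρ * V t + ε t) :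
    Tendsto V atTop (𝓝 0) := by
  -- replacing `ρ` by a smaller rate keeps the recursion, since `V` is nonnegative
  obtain ⟨r, hr0, hr1, hrρ⟩ : ∃ r : ℝ, 0 < r ∧ r < 1 ∧ r ≤ ρ :=
    ⟨min ρ (1 / 2), by positivity, by
      have := min_le_right ρ (1 / 2); linarith, min_le_left _ _⟩
  rw [Metric.tendsto_atTop]
  intro e he
  have hev : ∀ᶠ t in atTop, V (t + 1) ≤ (1 - r) * V t + r * (e / 2) := by
    filter_upwards [hrec, hε.eventually_le_const (show (0 : ℝ) < r * (e / 2) by positivity)]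
      with t h1 h2
    nlinarith [mul_le_mul_of_nonneg_right hrρ (hV t)]
  obtain ⟨T, hT⟩ := eventually_atTop.mp hev
  have hgeo : ∀ n, V (T + n) ≤ e / 2 + (1 - r) ^ n * V T := by
    intro n
    induction n with
    | zero => simp; linarith
    | succ n ih =>
      have := hT (T + n) (by omega)
      have h3 := mul_le_mul_of_nonneg_left ih (show 0 ≤ 1 - r by linarith)
      rw [← add_assoc, pow_succ]
      nlinarith
  have hlim : Tendsto (fun n : ℕ => (1 - r) ^ n * V T) atTop (𝓝 0) := by
    simpa using (tendsto_pow_atTop_nhds_zero_of_lt_one (show 0 ≤ 1 - r by linarith)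
      (by linarith)).mul_const (V T)
  obtain ⟨n₀, hn₀⟩ := eventually_atTop.mp (hlim.eventually_lt_const (half_pos he))
  refine ⟨T + n₀, fun t ht => ?_⟩
  obtain ⟨n, rfl⟩ := Nat.exists_eq_add_of_le (show T ≤ t by omega)
  rw [Real.dist_eq, sub_zero, abs_of_nonneg (hV _)]
  linarith [hgeo n, hn₀ n (by omega)]

/-! ### Norm estimates for dot products and quadratic forms -/

section Deterministic

-- vectors carry the sup norm, matrices the operator norm that belongs to it
attribute [local instance] Matrix.linftyOpNormedAddCommGroup

lemma abs_dotProduct_le {K : ℕ} (x y : Fin K → ℝ) : |x ⬝ᵥ y| ≤ K * ‖x‖ * ‖y‖ := by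
  calc |x ⬝ᵥ y| ≤ ∑ i, |x i * y i| := Finset.abs_sum_le_sum_abs _ _
    _ ≤ ∑ _i : Fin K, ‖x‖ * ‖y‖ := by
        refine Finset.sum_le_sum fun i _ => ?_
        rw [abs_mul]
        exact mul_le_mul (norm_le_pi_norm x i) (norm_le_pi_norm y i) (abs_nonneg _) (norm_nonneg _)
    _ = K * ‖x‖ * ‖y‖ := by simp [mul_assoc]

lemma abs_quadratic_le {K : ℕ} (A : Matrix (Fin K) (Fin K) ℝ) (x : Fin K → ℝ) :
    |x ⬝ᵥ A.mulVec x| ≤ K * ‖A‖ * ‖x‖ ^ 2 := by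
  calc |x ⬝ᵥ A.mulVec x| ≤ K * ‖x‖ * ‖A.mulVec x‖ := abs_dotProduct_le _ _
    _ ≤ K * ‖x‖ * (‖A‖ * ‖x‖) := by gcongr; exact Matrix.linfty_opNorm_mulVec A x
    _ = K * ‖A‖ * ‖x‖ ^ 2 := by ring

lemma abs_apply_le_norm {K : ℕ} (A : Matrix (Fin K) (Fin K) ℝ) (i j : Fin K) :
    |A i j| ≤ ‖A‖ := by
  have h := (norm_le_pi_norm (A.mulVec (Pi.single j 1)) i).trans
    (Matrix.linfty_opNorm_mulVec A (Pi.single j 1))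
  have h1 : ‖(Pi.single j 1 : Fin K → ℝ)‖ ≤ 1 := by
    refine (pi_norm_le_iff_of_nonneg zero_le_one).2 fun k => ?_
    by_cases hk : k = j
    · subst hk; simp
    · simp [hk]
  have h2 : (A.mulVec (Pi.single j 1)) i = A i j := by simp
  rw [h2, Real.norm_eq_abs] at h
  exact h.trans (mul_le_of_le_one_right (norm_nonneg _) h1)

lemma l1norm_nonneg {K : ℕ} (x : Fin K → ℝ) : 0 ≤ l1norm x :=
  Finset.sum_nonneg fun _ _ => abs_nonneg _

lemma l1norm_le {K : ℕ} (x : Fin K → ℝ) : l1norm x ≤ K * ‖x‖ := by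
  calc l1norm x ≤ ∑ _i : Fin K, ‖x‖ := Finset.sum_le_sum fun i _ => norm_le_pi_norm x i
    _ = K * ‖x‖ := by simp

lemma norm_sq_le_sum_sq {K : ℕ} (x : Fin K → ℝ) : ‖x‖ ^ 2 ≤ ∑ k, x k ^ 2 := by
  have h : ‖x‖ ≤ √(∑ k, x k ^ 2) := by
    refine (pi_norm_le_iff_of_nonneg (Real.sqrt_nonneg _)).2 fun k => ?_
    refine Real.le_sqrt_of_sq_le ?_
    rw [Real.norm_eq_abs, sq_abs]
    exact Finset.single_le_sum (f := fun k => x k ^ 2) (fun _ _ => sq_nonneg _) (Finset.mem_univ k)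
  calc ‖x‖ ^ 2 ≤ √(∑ k, x k ^ 2) ^ 2 := by gcongr
    _ = _ := Real.sq_sqrt (Finset.sum_nonneg fun _ _ => sq_nonneg _)

/-- Strong convexity of a positive definite quadratic form, by compactness of the unit sphere. -/
lemma exists_pos_mul_norm_sq_le {K : ℕ} {G : Matrix (Fin K) (Fin K) ℝ} (hG : G.PosDef) :
    ∃ m : ℝ, 0 < m ∧ ∀ x : Fin K → ℝ, m * ‖x‖ ^ 2 ≤ x ⬝ᵥ G.mulVec x := by
  rcases subsingleton_or_nontrivial (Fin K → ℝ) with hs | hn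
  · exact ⟨1, one_pos, fun x => by rw [Subsingleton.elim x 0]; simp⟩
  · have hcont : Continuous fun x : Fin K → ℝ => x ⬝ᵥ G.mulVec x := by fun_prop
    obtain ⟨u, hu, hmin⟩ := (isCompact_sphere (0 : Fin K → ℝ) 1).exists_isMinOn
      (NormedSpace.sphere_nonempty.2 zero_le_one) hcont.continuousOn
    have hu0 : u ≠ 0 := by rintro rfl; simp at hu
    refine ⟨u ⬝ᵥ G.mulVec u, by simpa using hG.dotProduct_mulVec_pos hu0, fun x => ?_⟩
    by_cases hx : x = 0
    · simp [hx]
    have hx' : 0 < ‖x‖ := norm_pos_iff.mpr hx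
    have hmem : ‖x‖⁻¹ • x ∈ Metric.sphere (0 : Fin K → ℝ) 1 := by
      rw [mem_sphere_zero_iff_norm, norm_smul, norm_inv, norm_norm, inv_mul_cancel₀ hx'.ne']
    have h := isMinOn_iff.mp hmin _ hmem
    rw [Matrix.mulVec_smul, smul_dotProduct, dotProduct_smul, smul_eq_mul, smul_eq_mul] at h
    calc u ⬝ᵥ G.mulVec u * ‖x‖ ^ 2
        ≤ ‖x‖⁻¹ * (‖x‖⁻¹ * (x ⬝ᵥ G.mulVec x)) * ‖x‖ ^ 2 := by gcongr
      _ = x ⬝ᵥ G.mulVec x := by field_simp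

/-- An error bound: the gradient `G z` controls the value of the quadratic form at `z`. -/
lemma mul_quadratic_le_norm_mulVec_sq {K : ℕ} {G : Matrix (Fin K) (Fin K) ℝ} {m : ℝ} (hm : 0 < m)
    (hG : ∀ x : Fin K → ℝ, m * ‖x‖ ^ 2 ≤ x ⬝ᵥ G.mulVec x) (z : Fin K → ℝ) :
    m * (z ⬝ᵥ G.mulVec z) ≤ (K * ‖G.mulVec z‖) ^ 2 := by
  have h1 := hG z
  have h2 := (le_abs_self _).trans (abs_dotProduct_le z (G.mulVec z))
  have hn := norm_nonneg z
  set n := ‖z‖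
  set w := (K : ℝ) * ‖G.mulVec z‖ with hw
  have hw0 : 0 ≤ w := by positivity
  have h3 : z ⬝ᵥ G.mulVec z ≤ n * w := by rw [hw]; linarith
  rcases hn.eq_or_lt with h0 | h0
  · rw [← h0] at h3; nlinarith [sq_nonneg w]
  · have h4 : m * n ≤ w := by
      by_contra! h
      nlinarith
    nlinarith

/-! ### One step of the algorithm for fixed data -/

lemma isSymm_of_isHermitian {K : ℕ} {G : Matrix (Fin K) (Fin K) ℝ} (hG : G.IsHermitian) :
    G.IsSymm := by
  have := hG.eq
  rwa [Matrix.conjTranspose_eq_transpose_of_trivial] at this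

lemma dotProduct_mulVec_comm {K : ℕ} {G : Matrix (Fin K) (Fin K) ℝ} (hG : G.IsSymm)
    (x y : Fin K → ℝ) : x ⬝ᵥ G.mulVec y = y ⬝ᵥ G.mulVec x := by
  rw [Matrix.dotProduct_mulVec, ← Matrix.mulVec_transpose, hG.eq, dotProduct_comm]

/-- Along the segment from `x` to `xhat` the objective lies below the quadratic minimized by the
stepsize rule, since the `ℓ₁`-norm is convex. -/
lemma lassoObjective_segment_le {K : ℕ} {G : Matrix (Fin K) (Fin K) ℝ} (hG : G.IsSymm)
    (b : Fin K → ℝ) {μ : ℝ} (hμ : 0 ≤ μ) (x xhat : Fin K → ℝ) {γ : ℝ} (h0 : 0 ≤ γ) (h1 : γ ≤ 1) :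
    lassoObjective G b μ (x + γ • (xhat - x)) ≤ lassoObjective G b μ x
      + (1 / 2 * ((xhat - x) ⬝ᵥ G.mulVec (xhat - x)) * γ ^ 2
        + ((G.mulVec x - b) ⬝ᵥ (xhat - x) + μ * (l1norm xhat - l1norm x)) * γ) := by
  have hl1 : l1norm (x + γ • (xhat - x)) ≤ l1norm x + γ * (l1norm xhat - l1norm x) := by
    unfold l1norm
    rw [← Finset.sum_sub_distrib, Finset.mul_sum, ← Finset.sum_add_distrib]
    refine Finset.sum_le_sum fun k _ => ?_
    have e : (x + γ • (xhat - x)) k = (1 - γ) * x k + γ * xhat k := by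
      simp only [Pi.add_apply, Pi.smul_apply, Pi.sub_apply, smul_eq_mul]; ring
    rw [e]
    calc |(1 - γ) * x k + γ * xhat k| ≤ |(1 - γ) * x k| + |γ * xhat k| := abs_add_le _ _
      _ = (1 - γ) * |x k| + γ * |xhat k| := by
          rw [abs_mul, abs_mul, abs_of_nonneg h0, abs_of_nonneg (sub_nonneg.2 h1)]
      _ = |x k| + γ * (|xhat k| - |x k|) := by ring
  generalize xhat - x = d at *
  have e1 := dotProduct_mulVec_comm hG x d
  have e2 : (G.mulVec x) ⬝ᵥ d = d ⬝ᵥ G.mulVec x := dotProduct_comm _ _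
  unfold lassoObjective
  simp only [Matrix.mulVec_add, Matrix.mulVec_smul, dotProduct_add, add_dotProduct,
    smul_dotProduct, dotProduct_smul, sub_dotProduct, smul_eq_mul, e1, e2]
  nlinarith [mul_le_mul_of_nonneg_left hl1 hμ]

lemma mulVec_sub_apply_eq {K : ℕ} (G : Matrix (Fin K) (Fin K) ℝ) (b c x : Fin K → ℝ) (k : Fin K) :
    (G.mulVec x - b) k = (G k k + c k) * x k - (partialResidual G b x k + c k * x k) := by
  have h : G.mulVec x k = G k k * x k + ∑ j ∈ Finset.univ.erase k, G k j * x j :=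
    (Finset.add_sum_erase _ _ (Finset.mem_univ k)).symm
  rw [Pi.sub_apply, h, partialResidual]
  ring

/-- The direction towards the best response is a descent direction, with slope at most
`-c₀ ‖xhat - x‖²`. -/
lemma bestResponse_slope_le {K : ℕ} (G : Matrix (Fin K) (Fin K) ℝ) (b : Fin K → ℝ) {μ : ℝ}
    (hμ : 0 ≤ μ) (c x : Fin K → ℝ) {c₀ : ℝ} (hc₀ : 0 < c₀) (hc : ∀ k, c₀ ≤ G k k + c k) :
    (G.mulVec x - b) ⬝ᵥ (bestResponse G b μ c x - x)
      + μ * (l1norm (bestResponse G b μ c x) - l1norm x)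
      ≤ -(c₀ * ‖bestResponse G b μ c x - x‖ ^ 2) := by
  set z := bestResponse G b μ c x with hz
  have hk : ∀ k, (G.mulVec x - b) k * (z - x) k + μ * (|z k| - |x k|) ≤ -(c₀ * (z - x) k ^ 2) := by
    intro k
    have hv := softThreshold_div_variational hμ (hc₀.trans_le (hc k))
      (partialResidual G b x k + c k * x k) (x k)
    change (_ * z k - _) * (z k - x k) + μ * (|z k| - |x k|) ≤ 0 at hv
    rw [mulVec_sub_apply_eq G b c x k, Pi.sub_apply]
    nlinarith [mul_le_mul_of_nonneg_right (hc k) (sq_nonneg (z k - x k))]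
  calc (G.mulVec x - b) ⬝ᵥ (z - x) + μ * (l1norm z - l1norm x)
      = ∑ k, ((G.mulVec x - b) k * (z - x) k + μ * (|z k| - |x k|)) := by
        simp only [dotProduct, l1norm, Finset.sum_add_distrib, ← Finset.mul_sum,
          Finset.sum_sub_distrib]
    _ ≤ ∑ k, -(c₀ * (z - x) k ^ 2) := Finset.sum_le_sum fun k _ => hk k
    _ = -(c₀ * ∑ k, (z - x) k ^ 2) := by rw [Finset.sum_neg_distrib, Finset.mul_sum]
    _ ≤ -(c₀ * ‖z - x‖ ^ 2) := by
        have := mul_le_mul_of_nonneg_left (norm_sq_le_sum_sq (z - x)) hc₀.le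
        linarith

/-- Sufficient decrease: the exact line search does at least as well as the fixed step
`c₀ / A`, where `A` bounds the curvature. -/
lemma lassoObjective_intermediate_le {K : ℕ} {G : Matrix (Fin K) (Fin K) ℝ} (hG : G.PosSemidef)
    (b : Fin K → ℝ) {μ : ℝ} (hμ : 0 ≤ μ) (c x : Fin K → ℝ) {c₀ A : ℝ} (hc₀ : 0 < c₀)
    (hc : ∀ k, c₀ ≤ G k k + c k) (hA : c₀ ≤ A)
    (hGA : ∀ d : Fin K → ℝ, d ⬝ᵥ G.mulVec d ≤ A * ‖d‖ ^ 2) :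
    lassoObjective G b μ (intermediate G b μ c x) ≤ lassoObjective G b μ x
      - c₀ ^ 2 / (2 * A) * ‖bestResponse G b μ c x - x‖ ^ 2 := by
  have hsymm := isSymm_of_isHermitian hG.isHermitian
  have hA0 : 0 < A := hc₀.trans_le hA
  set z := bestResponse G b μ c x with hz
  set a := (z - x) ⬝ᵥ G.mulVec (z - x) with ha
  set β := (G.mulVec x - b) ⬝ᵥ (z - x) + μ * (l1norm z - l1norm x) with hβ
  have ha0 : 0 ≤ a := hG.dotProduct_mulVec_nonneg (z - x)
  have hγ := clippedMinimizer_mem a β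
  have h1 := lassoObjective_segment_le hsymm b hμ x z hγ.1 hγ.2
  have h2 := clippedMinimizer_le ha0 β (γ := c₀ / A) (by positivity)
    ((div_le_one hA0).2 hA)
  have h3 : β ≤ -(c₀ * ‖z - x‖ ^ 2) := bestResponse_slope_le G b hμ c x hc₀ hc
  have h4 : 1 / 2 * a * (c₀ / A) ^ 2 + β * (c₀ / A) ≤ -(c₀ ^ 2 / (2 * A) * ‖z - x‖ ^ 2) := by
    calc 1 / 2 * a * (c₀ / A) ^ 2 + β * (c₀ / A)
        ≤ 1 / 2 * (A * ‖z - x‖ ^ 2) * (c₀ / A) ^ 2 + -(c₀ * ‖z - x‖ ^ 2) * (c₀ / A) := by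
          gcongr
          exact hGA _
      _ = -(c₀ ^ 2 / (2 * A) * ‖z - x‖ ^ 2) := by field_simp; ring
  have h5 : intermediate G b μ c x = x + clippedMinimizer a β • (z - x) := rfl
  rw [h5]
  linarith

/-- The reset never increases the objective: it is applied only where the objective is positive,
and the objective vanishes at `0`. -/
lemma lassoObjective_nextEstimate_le {K : ℕ} (G : Matrix (Fin K) (Fin K) ℝ) (b : Fin K → ℝ) (μ : ℝ)
    (c x : Fin K → ℝ) :
    lassoObjective G b μ (nextEstimate G b μ c x) ≤ 0 ∧
      lassoObjective G b μ (nextEstimate G b μ c x)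
        ≤ lassoObjective G b μ (intermediate G b μ c x) := by
  have h0 : lassoObjective G b μ 0 = 0 := by simp [lassoObjective, l1norm]
  unfold nextEstimate
  split_ifs with h
  · exact ⟨h, le_rfl⟩
  · rw [h0]; exact ⟨le_rfl, (not_le.mp h).le⟩

/-- If the best response hardly moves `x`, then `x` almost solves the normal equations. -/
lemma norm_residual_le {K : ℕ} (G : Matrix (Fin K) (Fin K) ℝ) (b : Fin K → ℝ) {μ : ℝ}
    (hμ : 0 ≤ μ) (c x : Fin K → ℝ) {M : ℝ} (hM0 : 0 ≤ M) (hpos : ∀ k, 0 < G k k + c k)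
    (hM : ∀ k, G k k + c k ≤ M) :
    ‖G.mulVec x - b‖ ≤ M * ‖bestResponse G b μ c x - x‖ + μ := by
  refine (pi_norm_le_iff_of_nonneg (by positivity)).2 fun k => ?_
  set z := bestResponse G b μ c x with hz
  have hzk : (G k k + c k) * z k = softThreshold μ (partialResidual G b x k + c k * x k) := by
    rw [hz, bestResponse]; exact mul_div_cancel₀ _ (hpos k).ne'
  have h1 := abs_softThreshold_sub_le hμ (partialResidual G b x k + c k * x k)
  rw [← hzk] at h1
  have h2 : |(G k k + c k) * (z k - x k)| ≤ M * ‖z - x‖ := by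
    rw [abs_mul, abs_of_pos (hpos k)]
    exact mul_le_mul (hM k) (norm_le_pi_norm (z - x) k) (abs_nonneg _) hM0
  rw [mulVec_sub_apply_eq G b c x k, Real.norm_eq_abs, abs_le]
  rw [abs_le] at h1 h2
  constructor <;> linarith

/-- Boundedness of the sublevel set at level `0`. -/
lemma norm_le_of_lassoObjective_nonpos {K : ℕ} {G : Matrix (Fin K) (Fin K) ℝ} {b : Fin K → ℝ}
    {μ m B : ℝ} (hμ : 0 ≤ μ) (hm : 0 < m) (hG : ∀ x : Fin K → ℝ, m * ‖x‖ ^ 2 ≤ x ⬝ᵥ G.mulVec x)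
    (hb : ‖b‖ ≤ B) {x : Fin K → ℝ} (hx : lassoObjective G b μ x ≤ 0) :
    ‖x‖ ≤ 2 * K * B / m := by
  have h1 := hG x
  have h2 := (le_abs_self _).trans (abs_dotProduct_le b x)
  have h3 : (K : ℝ) * ‖b‖ * ‖x‖ ≤ K * B * ‖x‖ := by gcongr
  have h4 := mul_nonneg hμ (l1norm_nonneg x)
  have hB : 0 ≤ B := (norm_nonneg b).trans hb
  unfold lassoObjective at hx
  rw [le_div_iff₀ hm]
  rcases (norm_nonneg x).eq_or_lt with h0 | h0
  · rw [← h0]; simp; positivity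
  · by_contra! h
    nlinarith

/-! ### Comparison of the empirical objective with its limit -/

lemma abs_lassoObjective_sub_le {K : ℕ} (G G' : Matrix (Fin K) (Fin K) ℝ) (b b' : Fin K → ℝ)
    {μ R : ℝ} (hμ : 0 ≤ μ) {x : Fin K → ℝ} (hx : ‖x‖ ≤ R) :
    |lassoObjective G b μ x - lassoObjective G' b' 0 x|
      ≤ K * (1 / 2 * ‖G - G'‖ * R ^ 2 + ‖b - b'‖ * R + μ * R) := by
  have e : lassoObjective G b μ x - lassoObjective G' b' 0 x
      = 1 / 2 * (x ⬝ᵥ (G - G').mulVec x) - (b - b') ⬝ᵥ x + μ * l1norm x := by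
    unfold lassoObjective
    rw [Matrix.sub_mulVec, dotProduct_sub, sub_dotProduct]
    ring
  have h1 : |x ⬝ᵥ (G - G').mulVec x| ≤ K * ‖G - G'‖ * R ^ 2 :=
    (abs_quadratic_le _ _).trans (by gcongr)
  have h2 : |(b - b') ⬝ᵥ x| ≤ K * ‖b - b'‖ * R :=
    (abs_dotProduct_le _ _).trans (by gcongr)
  have h3 : μ * l1norm x ≤ μ * (K * R) :=
    mul_le_mul_of_nonneg_left ((l1norm_le x).trans (by gcongr)) hμ
  have h4 := mul_nonneg hμ (l1norm_nonneg x)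
  rw [e, abs_le]
  rw [abs_le] at h1 h2
  constructor <;> linarith

lemma lassoObjective_sub_min {K : ℕ} {G : Matrix (Fin K) (Fin K) ℝ} (hG : G.IsSymm)
    (xstar x : Fin K → ℝ) :
    lassoObjective G (G.mulVec xstar) 0 x - lassoObjective G (G.mulVec xstar) 0 xstar
      = 1 / 2 * ((x - xstar) ⬝ᵥ G.mulVec (x - xstar)) := by
  have e1 := dotProduct_mulVec_comm hG x xstar
  have e2 : (G.mulVec xstar) ⬝ᵥ x = x ⬝ᵥ G.mulVec xstar := dotProduct_comm _ _
  have e3 : (G.mulVec xstar) ⬝ᵥ xstar = xstar ⬝ᵥ G.mulVec xstar := dotProduct_comm _ _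
  unfold lassoObjective
  simp only [Matrix.mulVec_sub, dotProduct_sub, sub_dotProduct, e1, e2, e3]
  ring

/-! ### Convergence for deterministic data -/

/-- The gradient `Ginf (x - x⋆)` of the limit objective is bounded by the displacement of the best
response, up to errors that vanish with the data errors. -/
lemma norm_limit_gradient_le {K : ℕ} (G Ginf : Matrix (Fin K) (Fin K) ℝ) (b xstar : Fin K → ℝ)
    {μ : ℝ} (hμ : 0 ≤ μ) (c : Fin K → ℝ) {x : Fin K → ℝ} {M R : ℝ} (hM0 : 0 ≤ M)
    (hpos : ∀ k, 0 < G k k + c k) (hM : ∀ k, G k k + c k ≤ M) (hx : ‖x‖ ≤ R) :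
    ‖Ginf.mulVec (x - xstar)‖ ≤ M * ‖bestResponse G b μ c x - x‖
      + (μ + ‖b - Ginf.mulVec xstar‖ + ‖G - Ginf‖ * R) := by
  have hres := norm_residual_le G b hμ c x hM0 hpos hM
  have e : Ginf.mulVec (x - xstar) = (G.mulVec x - b)
      + (b - Ginf.mulVec xstar) - (G - Ginf).mulVec x := by
    rw [Matrix.mulVec_sub, Matrix.sub_mulVec]; abel
  have h1 : ‖(G - Ginf).mulVec x‖ ≤ ‖G - Ginf‖ * R :=
    (Matrix.linfty_opNorm_mulVec _ _).trans (by gcongr)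
  have h2 := norm_add_le (G.mulVec x - b) (b - Ginf.mulVec xstar)
  rw [e]
  refine (norm_sub_le _ _).trans ?_
  linarith

/-- The displacement of the best response is at least proportional to the optimality gap
`v = ½ (x - x⋆)ᵀ Ginf (x - x⋆)`, up to the gradient error `w`. -/
lemma gap_le_displacement_sq {K : ℕ} {Ginf : Matrix (Fin K) (Fin K) ℝ} {m M w n : ℝ} (hm : 0 < m)
    (hM : 0 < M) (hG : ∀ x : Fin K → ℝ, m * ‖x‖ ^ 2 ≤ x ⬝ᵥ Ginf.mulVec x) {z : Fin K → ℝ}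
    (hgrad : ‖Ginf.mulVec z‖ ≤ M * n + w) :
    m / (((K : ℝ) + 1) ^ 2 * M ^ 2) * (1 / 2 * (z ⬝ᵥ Ginf.mulVec z)) - w ^ 2 / M ^ 2 ≤ n ^ 2 := by
  have herr := mul_quadratic_le_norm_mulVec_sq hm hG z
  have h1 : (K * ‖Ginf.mulVec z‖) ^ 2 ≤ ((K + 1) * (M * n + w)) ^ 2 := by
    gcongr
    linarith
  have h2 : (M * n + w) ^ 2 ≤ 2 * (M ^ 2 * n ^ 2 + w ^ 2) := by
    nlinarith [sq_nonneg (M * n - w)]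
  rw [mul_pow ((K : ℝ) + 1)] at h1
  have h4 := mul_le_mul_of_nonneg_left h2 (sq_nonneg ((K : ℝ) + 1))
  have h5 : m / (((K : ℝ) + 1) ^ 2 * M ^ 2) * (1 / 2 * (z ⬝ᵥ Ginf.mulVec z)) - w ^ 2 / M ^ 2
      = (m * (1 / 2 * (z ⬝ᵥ Ginf.mulVec z)) - ((K : ℝ) + 1) ^ 2 * w ^ 2)
        / (((K : ℝ) + 1) ^ 2 * M ^ 2) := by
    field_simp
  rw [h5, div_le_iff₀ (by positivity)]
  linarith

/-- One step decreases the limit objective as it decreases the empirical one, up to twice their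
distance on the ball of radius `R`. -/
lemma gap_nextEstimate_le {K : ℕ} {G Ginf : Matrix (Fin K) (Fin K) ℝ} (hG : G.PosSemidef)
    (hGinf : Ginf.IsSymm) (b xstar : Fin K → ℝ) {μ : ℝ} (hμ : 0 ≤ μ) (c : Fin K → ℝ)
    {x : Fin K → ℝ} {c₀ A R : ℝ} (hc₀ : 0 < c₀) (hc : ∀ k, c₀ ≤ G k k + c k) (hA : c₀ ≤ A)
    (hGA : ∀ d : Fin K → ℝ, d ⬝ᵥ G.mulVec d ≤ A * ‖d‖ ^ 2) (hx : ‖x‖ ≤ R)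
    (hx' : ‖nextEstimate G b μ c x‖ ≤ R) :
    1 / 2 * ((nextEstimate G b μ c x - xstar)
        ⬝ᵥ Ginf.mulVec (nextEstimate G b μ c x - xstar))
      ≤ 1 / 2 * ((x - xstar) ⬝ᵥ Ginf.mulVec (x - xstar))
        - c₀ ^ 2 / (2 * A) * ‖bestResponse G b μ c x - x‖ ^ 2
        + 2 * (K * (1 / 2 * ‖G - Ginf‖ * R ^ 2 + ‖b - Ginf.mulVec xstar‖ * R + μ * R)) := by
  have hdesc := lassoObjective_intermediate_le hG b hμ c x hc₀ hc hA hGA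
  have hnext := (lassoObjective_nextEstimate_le G b μ c x).2
  have hE1 := (abs_le.1 (abs_lassoObjective_sub_le G Ginf b (Ginf.mulVec xstar) hμ hx)).2
  have hE2 := (abs_le.1 (abs_lassoObjective_sub_le G Ginf b (Ginf.mulVec xstar) hμ hx')).1
  rw [← lassoObjective_sub_min hGinf, ← lassoObjective_sub_min hGinf]
  linarith

lemma eventually_norm_nextEstimate_le {K : ℕ} {G : ℕ → Matrix (Fin K) (Fin K) ℝ}
    {Ginf : Matrix (Fin K) (Fin K) ℝ} {b : ℕ → Fin K → ℝ} {binf : Fin K → ℝ} {μ : ℕ → ℝ}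
    {c : ℕ → Fin K → ℝ} {x : ℕ → Fin K → ℝ} {m : ℝ} (hm : 0 < m)
    (hmG : ∀ x : Fin K → ℝ, m * ‖x‖ ^ 2 ≤ x ⬝ᵥ Ginf.mulVec x)
    (hδ : Tendsto (fun s => ‖G s - Ginf‖) atTop (𝓝 0))
    (hβ : Tendsto (fun s => ‖b s - binf‖) atTop (𝓝 0)) (hμ : ∀ s, 0 ≤ μ s) :
    ∀ᶠ s in atTop, ‖nextEstimate (G s) (b s) (μ s) (c s) (x s)‖
      ≤ 2 * K * (‖binf‖ + 1) / (m / 2) := by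
  have hδK : Tendsto (fun s => K * ‖G s - Ginf‖) atTop (𝓝 0) := by
    simpa only [mul_zero] using hδ.const_mul (K : ℝ)
  filter_upwards [hδK.eventually_le_const (half_pos hm), hβ.eventually_le_const zero_lt_one]
    with s h2 h3
  refine norm_le_of_lassoObjective_nonpos (hμ s) (half_pos hm) (fun y => ?_) ?_
    (lassoObjective_nextEstimate_le (G s) (b s) (μ s) (c s) (x s)).1
  · have e : y ⬝ᵥ (G s).mulVec y = y ⬝ᵥ Ginf.mulVec y + y ⬝ᵥ (G s - Ginf).mulVec y := by
      rw [Matrix.sub_mulVec, dotProduct_sub]; ring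
    have h4 := (abs_le.1 (abs_quadratic_le (G s - Ginf) y)).1
    have h5 := mul_le_mul_of_nonneg_right h2 (sq_nonneg ‖y‖)
    have h6 := hmG y
    rw [e]
    linarith
  · have := norm_add_le (b s - binf) binf
    rw [sub_add_cancel] at this
    linarith

/-- For data whose averages converge, the gap `½ (x s - x⋆)ᵀ Ginf (x s - x⋆)` obeys a contraction
with vanishing errors: a step decreases it by a multiple of the squared displacement of the best
response, which in turn dominates a multiple of the gap. -/
theorem tendsto_of_tendsto_data {K : ℕ} {G : ℕ → Matrix (Fin K) (Fin K) ℝ}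
    {Ginf : Matrix (Fin K) (Fin K) ℝ} {b : ℕ → Fin K → ℝ} {xstar : Fin K → ℝ} {μ : ℕ → ℝ}
    {c : ℕ → Fin K → ℝ} {x : ℕ → Fin K → ℝ}
    (hG : ∀ s, (G s).PosSemidef) (hGinf : Ginf.PosDef)
    (hGlim : Tendsto G atTop (𝓝 Ginf)) (hblim : Tendsto b atTop (𝓝 (Ginf.mulVec xstar)))
    (hμ : ∀ s, 0 ≤ μ s) (hμ_lim : Tendsto μ atTop (𝓝 0))
    {C c₀ : ℝ} (hC : ∀ s k, c s k ≤ C) (hc₀ : 0 < c₀) (hc : ∀ s k, c₀ ≤ G s k k + c s k)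
    (hx : ∀ s, x (s + 1) = nextEstimate (G s) (b s) (μ s) (c s) (x s)) :
    Tendsto x atTop (𝓝 xstar) := by
  have hsymm := isSymm_of_isHermitian hGinf.isHermitian
  have hδ : Tendsto (fun s => ‖G s - Ginf‖) atTop (𝓝 0) :=
    tendsto_iff_norm_sub_tendsto_zero.1 hGlim
  have hβ : Tendsto (fun s => ‖b s - Ginf.mulVec xstar‖) atTop (𝓝 0) :=
    tendsto_iff_norm_sub_tendsto_zero.1 hblim
  obtain ⟨m, hm, hmG⟩ := exists_pos_mul_norm_sq_le hGinf
  obtain ⟨R, hR⟩ : ∃ R, ∀ᶠ s in atTop, ‖x (s + 1)‖ ≤ R := by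
    simp only [hx]
    exact ⟨_, eventually_norm_nextEstimate_le hm hmG hδ hβ hμ⟩
  have hR' : ∀ᶠ s in atTop, ‖x s‖ ≤ R := (eventually_map (m := fun s => s + 1)).2 hR |>.filter_mono
    (map_add_atTop_eq_nat 1).ge
  -- `A` bounds the curvature of the objective, `M` the denominators of the best response
  obtain ⟨A, hA⟩ : ∃ A, A = K * (‖Ginf‖ + 1) + c₀ := ⟨_, rfl⟩
  obtain ⟨M, hM⟩ : ∃ M, M = ‖Ginf‖ + 1 + |C| := ⟨_, rfl⟩
  have hA0 : c₀ ≤ A := by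
    have : 0 ≤ K * (‖Ginf‖ + 1) := by positivity
    linarith
  have hApos : 0 < A := hc₀.trans_le hA0
  have hM0 : 0 < M := by rw [hM]; positivity
  have hGnorm : ∀ᶠ s in atTop, ‖G s‖ ≤ ‖Ginf‖ + 1 := by
    filter_upwards [hδ.eventually_le_const zero_lt_one] with s h
    have := norm_add_le (G s - Ginf) Ginf
    rw [sub_add_cancel] at this
    linarith
  -- discrepancy of the objectives and of their gradients on the ball of radius `R`
  have hElim : Tendsto (fun s => K * (1 / 2 * ‖G s - Ginf‖ * R ^ 2
      + ‖b s - Ginf.mulVec xstar‖ * R + μ s * R)) atTop (𝓝 0) := by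
    simpa only [mul_zero, zero_mul, add_zero] using
      ((((hδ.const_mul (1 / 2)).mul_const (R ^ 2)).add (hβ.mul_const R)).add
        (hμ_lim.mul_const R)).const_mul (K : ℝ)
  have hWlim : Tendsto (fun s => μ s + ‖b s - Ginf.mulVec xstar‖ + ‖G s - Ginf‖ * R)
      atTop (𝓝 0) := by
    simpa only [zero_mul, add_zero] using (hμ_lim.add hβ).add (hδ.mul_const R)
  have herr := (hElim.const_mul 2).add
    (((hWlim.pow 2).div_const (M ^ 2)).const_mul (c₀ ^ 2 / (2 * A)))
  have hVlim : Tendsto (fun s => 1 / 2 * ((x s - xstar) ⬝ᵥ Ginf.mulVec (x s - xstar)))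
      atTop (𝓝 0) := by
    refine tendsto_zero_of_le_sub_mul_add
      (ρ := c₀ ^ 2 / (2 * A) * (m / (((K : ℝ) + 1) ^ 2 * M ^ 2))) (by positivity) (fun s => ?_)
      (by simpa only [mul_zero, add_zero, zero_pow two_ne_zero, zero_div] using herr) ?_
    · have := hmG (x s - xstar)
      have := mul_nonneg hm.le (sq_nonneg ‖x s - xstar‖)
      linarith
    · filter_upwards [hGnorm, hR', hR] with s hs1 hs2 hs3
      rw [hx s] at hs3 ⊢
      have hstep := gap_nextEstimate_le (hG s) hsymm (b s) xstar (hμ s) (c s) hc₀ (hc s) hA0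
        (fun y => by
          refine (le_abs_self _).trans ((abs_quadratic_le (G s) y).trans ?_)
          gcongr
          have : (K : ℝ) * ‖G s‖ ≤ K * (‖Ginf‖ + 1) := by gcongr
          linarith) hs2 hs3
      have hgrad := norm_limit_gradient_le (G s) Ginf (b s) xstar (hμ s) (c s) hM0.le
        (fun k => hc₀.trans_le (hc s k)) (fun k => by
          have h1 := (le_abs_self _).trans (abs_apply_le_norm (G s) k k)
          have h2 := (hC s k).trans (le_abs_self C)
          linarith) hs2
      have hkey := mul_le_mul_of_nonneg_left (gap_le_displacement_sq hm hM0 hmG hgrad)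
        (show 0 ≤ c₀ ^ 2 / (2 * A) by positivity)
      linarith
  rw [tendsto_iff_norm_sub_tendsto_zero]
  have hsq : Tendsto (fun s => ‖x s - xstar‖ ^ 2) atTop (𝓝 0) := by
    refine squeeze_zero (fun s => sq_nonneg _) (fun s => ?_)
      (by simpa only [mul_zero] using hVlim.const_mul (2 / m))
    calc ‖x s - xstar‖ ^ 2 = 1 / m * (m * ‖x s - xstar‖ ^ 2) := by field_simp
      _ ≤ 1 / m * ((x s - xstar) ⬝ᵥ Ginf.mulVec (x s - xstar)) := by gcongr; exact hmG _
      _ = 2 / m * (1 / 2 * ((x s - xstar) ⬝ᵥ Ginf.mulVec (x s - xstar))) := by ring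
  simpa using hsq.sqrt

end Deterministic

/-! ### Almost sure convergence of the sample averages -/

lemma sampleGram_posSemidef {N K : ℕ} (g : ℕ → Fin N → Fin K → ℝ) (s : ℕ) :
    (sampleGram g s).PosSemidef := by
  refine Matrix.PosSemidef.smul ?_ (by positivity)
  refine Matrix.posSemidef_sum _ fun τ _ => Matrix.posSemidef_sum _ fun n _ => ?_
  simpa using Matrix.posSemidef_vecMulVec_self_star (g τ n)

lemma sampleGram_apply {N K : ℕ} (g : ℕ → Fin N → Fin K → ℝ) (s : ℕ) (j k : Fin K) :
    sampleGram g s j k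
      = ((s : ℝ) + 1)⁻¹ * ∑ τ ∈ Finset.range (s + 1), ∑ n, g τ n j * g τ n k := by
  simp [sampleGram, Matrix.sum_apply, Matrix.vecMulVec_apply]

/-- Under the linear model the normal equations hold at `xstar` up to the averaged product of noise
and regressors. -/
lemma sampleCross_measurement {N K : ℕ} (xstar : Fin K → ℝ) (g : ℕ → Fin N → Fin K → ℝ)
    (v : ℕ → Fin N → ℝ) (s : ℕ) :
    sampleCross g (measurement xstar g v) s
      = (sampleGram g s).mulVec xstar + sampleCross g v s := by
  simp only [sampleCross, sampleGram, measurement, Matrix.smul_mulVec, Matrix.sum_mulVec,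
    ← smul_add, ← Finset.sum_add_distrib, Matrix.vecMulVec_mulVec, add_smul]
  simp

section Stochastic

variable {Ω : Type*} [MeasurableSpace Ω] {P : Measure Ω}

/-- The strong law of large numbers for a real statistic `F` of i.i.d. samples. -/
lemma ae_tendsto_average_comp {α : Type*} [MeasurableSpace α] {Z : ℕ → Ω → α}
    (hindep : iIndepFun Z P) (hident : ∀ s s', IdentDistrib (Z s) (Z s') P P)
    {F : α → ℝ} (hF : Measurable F) (hint : Integrable (fun ω => F (Z 0 ω)) P) :
    ∀ᵐ ω ∂P, Tendsto (fun s : ℕ => ((s : ℝ) + 1)⁻¹ * ∑ τ ∈ Finset.range (s + 1), F (Z τ ω))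
      atTop (𝓝 (∫ ω, F (Z 0 ω) ∂P)) := by
  have h := strong_law_ae (μ := P) (fun s ω => F (Z s ω)) hint
    (fun i j hij => (hindep.indepFun hij).comp hF hF) (fun i => (hident i 0).comp hF)
  filter_upwards [h] with ω hω
  simpa [Function.comp_def] using hω.comp (tendsto_add_atTop_nat 1)

/-- The second moment matrix `∑ n, E[g_n g_nᵀ]` of one sample of regression vectors. -/
noncomputable def momentMatrix {N K : ℕ} (P : Measure Ω) (g : Fin N → Ω → Fin K → ℝ) :
    Matrix (Fin K) (Fin K) ℝ :=
  Matrix.of fun j k => ∑ n, ∫ ω, g n ω j * g n ω k ∂P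

lemma momentMatrix_posDef [IsProbabilityMeasure P] {N K : ℕ} (hN : 1 ≤ N)
    {g : Fin N → Ω → Fin K → ℝ}
    (hg : ∀ n, MemLp (g n) 2 P)
    (hcov : ∀ n, (Matrix.of fun j k : Fin K =>
      covariance (fun ω => g n ω j) (fun ω => g n ω k) P).PosDef) :
    (momentMatrix P g).PosDef := by
  have hdecomp : momentMatrix P g = ∑ n, ((Matrix.of fun j k : Fin K =>
      covariance (fun ω => g n ω j) (fun ω => g n ω k) P)
      + Matrix.vecMulVec (fun j => ∫ ω, g n ω j ∂P) (fun j => ∫ ω, g n ω j ∂P)) := by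
    ext j k
    simp only [momentMatrix, Matrix.of_apply, Matrix.sum_apply, Matrix.add_apply,
      Matrix.vecMulVec_apply]
    refine Finset.sum_congr rfl fun n _ => ?_
    rw [covariance_eq_sub ((hg n).eval j) ((hg n).eval k)]
    simp
  have hn : ∀ n, ((Matrix.of fun j k : Fin K =>
      covariance (fun ω => g n ω j) (fun ω => g n ω k) P)
      + Matrix.vecMulVec (fun j => ∫ ω, g n ω j ∂P) (fun j => ∫ ω, g n ω j ∂P)).PosDef :=
    fun n => (hcov n).add_posSemidef
      (by simpa using Matrix.posSemidef_vecMulVec_self_star fun j => ∫ ω, g n ω j ∂P)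
  have : NeZero N := ⟨by omega⟩
  rw [hdecomp, ← Finset.add_sum_erase _ _ (Finset.mem_univ (0 : Fin N))]
  exact (hn 0).add_posSemidef (Matrix.posSemidef_sum _ fun n _ => (hn n).posSemidef)

lemma ae_tendsto_sampleGram {N K : ℕ} {g : ℕ → Fin N → Ω → Fin K → ℝ} {v : ℕ → Fin N → Ω → ℝ}
    (hindep : iIndepFun (fun s ω n => (g s n ω, v s n ω)) P)
    (hident : ∀ s s', IdentDistrib (fun ω n => (g s n ω, v s n ω))
      (fun ω n => (g s' n ω, v s' n ω)) P P)
    (hg : ∀ n, MemLp (g 0 n) 2 P) :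
    ∀ᵐ ω ∂P, Tendsto (fun s => sampleGram (fun τ n => g τ n ω) s) atTop
      (𝓝 (momentMatrix P (g 0))) := by
  have hentry : ∀ j k, ∀ᵐ ω ∂P, Tendsto (fun s => sampleGram (fun τ n => g τ n ω) s j k) atTop
      (𝓝 (momentMatrix P (g 0) j k)) := by
    intro j k
    have hint : ∀ n, Integrable (fun ω => g 0 n ω j * g 0 n ω k) P := fun n =>
      ((hg n).eval j).integrable_mul ((hg n).eval k)
    have h := ae_tendsto_average_comp hindep hident
      (F := fun z : Fin N → (Fin K → ℝ) × ℝ => ∑ n, (z n).1 j * (z n).1 k) (by fun_prop)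
      (integrable_finsetSum _ fun n _ => hint n)
    rw [integral_finsetSum _ fun n _ => hint n] at h
    filter_upwards [h] with ω hω
    simpa only [sampleGram_apply, momentMatrix, Matrix.of_apply] using hω
  have hall := ae_all_iff.2 fun j => ae_all_iff.2 (hentry j)
  filter_upwards [hall] with ω hω
  exact tendsto_pi_nhds.2 fun j => tendsto_pi_nhds.2 (hω j)

lemma ae_tendsto_sampleCross_noise [IsProbabilityMeasure P] {N K : ℕ}
    {g : ℕ → Fin N → Ω → Fin K → ℝ}
    {v : ℕ → Fin N → Ω → ℝ}
    (hindep : iIndepFun (fun s ω n => (g s n ω, v s n ω)) P)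
    (hident : ∀ s s', IdentDistrib (fun ω n => (g s n ω, v s n ω))
      (fun ω n => (g s' n ω, v s' n ω)) P P)
    (hg : ∀ n, MemLp (g 0 n) 2 P) (hv : ∀ n, MemLp (v 0 n) 2 P)
    (hv_mean : ∀ n, ∫ ω, v 0 n ω ∂P = 0)
    (hgv : ∀ n k, covariance (v 0 n) (fun ω => g 0 n ω k) P = 0) :
    ∀ᵐ ω ∂P, Tendsto (fun s => sampleCross (fun τ n => g τ n ω) (fun τ n => v τ n ω) s) atTop
      (𝓝 0) := by
  have hentry : ∀ k, ∀ᵐ ω ∂P, Tendsto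
      (fun s => sampleCross (fun τ n => g τ n ω) (fun τ n => v τ n ω) s k) atTop (𝓝 0) := by
    intro k
    have hint : ∀ n, Integrable (fun ω => v 0 n ω * g 0 n ω k) P := fun n =>
      (hv n).integrable_mul ((hg n).eval k)
    have hzero : ∀ n, ∫ ω, v 0 n ω * g 0 n ω k ∂P = 0 := fun n => by
      have h := covariance_eq_sub (hv n) ((hg n).eval k)
      rw [hgv n k, hv_mean n, zero_mul, sub_zero] at h
      simpa using h.symm
    have h := ae_tendsto_average_comp hindep hident
      (F := fun z : Fin N → (Fin K → ℝ) × ℝ => ∑ n, (z n).2 * (z n).1 k) (by fun_prop)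
      (integrable_finsetSum _ fun n _ => hint n)
    rw [integral_finsetSum _ fun n _ => hint n, Finset.sum_eq_zero fun n _ => hzero n] at h
    filter_upwards [h] with ω hω
    simpa [sampleCross, Finset.sum_apply] using hω
  filter_upwards [ae_all_iff.2 hentry] with ω hω
  exact tendsto_pi_nhds.2 hω

end Stochastic

end OnlineParallel

theorem theorem1 {Ω : Type*} [MeasurableSpace Ω] (P : Measure Ω) [IsProbabilityMeasure P]
    (N K : ℕ) (hN : 1 ≤ N)
    -- the signal, the regression vectors and the noise
    (xstar : Fin K → ℝ)
    (g : ℕ → Fin N → Ω → Fin K → ℝ) (v : ℕ → Fin N → Ω → ℝ)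
    (hg_meas : ∀ s n, Measurable (g s n)) (hv_meas : ∀ s n, Measurable (v s n))
    -- the data received at the successive time instances are i.i.d. samples
    (hsample_indep : iIndepFun (fun s ω n => (g s n ω, v s n ω)) P)
    (hsample_ident : ∀ s s', IdentDistrib (fun ω n => (g s n ω, v s n ω))
      (fun ω n => (g s' n ω, v s' n ω)) P P)
    -- (A1)
    (hg_indep : ∀ s, iIndepFun (fun n => g s n) P)
    (hg_ident : ∀ s m n, IdentDistrib (g s m) (g s n) P P)
    (hg_sq : ∀ s n, MemLp (g s n) 2 P)
    (hg_cov : ∀ s n, (Matrix.of fun j k : Fin K =>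
      covariance (fun ω => g s n ω j) (fun ω => g s n ω k) P).PosDef)
    -- (A2)
    (hv_indep : ∀ s, iIndepFun (fun n => v s n) P)
    (hv_ident : ∀ s m n, IdentDistrib (v s m) (v s n) P P)
    (hv_mean : ∀ s n, ∫ ω, v s n ω ∂P = 0)
    (hv_sq : ∀ s n, MemLp (v s n) 2 P)
    (hgv : ∀ s n k, covariance (v s n) (fun ω => g s n ω k) P = 0)
    -- (A3)
    (μ : ℕ → ℝ) (hμ_pos : ∀ s, 0 < μ s) (hμ_lim : Tendsto μ atTop (𝓝 0))
    -- (A4)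
    (hg_mom : ∀ s n, ∀ p : ℕ, MemLp (g s n) p P)
    (hv_mom : ∀ s n, ∀ p : ℕ, MemLp (v s n) p P)
    -- (A5), for nonnegative and bounded proximal weights
    (c : ℕ → Ω → Fin K → ℝ) (hc_nonneg : ∀ s ω k, 0 ≤ c s ω k)
    (hc_bdd : ∀ᵐ ω ∂P, ∃ C : ℝ, ∀ s k, c s ω k ≤ C)
    (hc : ∀ᵐ ω ∂P, ∃ c₀ : ℝ, 0 < c₀ ∧
      ∀ s k, c₀ ≤ OnlineParallel.sampleGram (fun τ n => g τ n ω) s k k + c s ω k)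
    -- (A6)
    (hμ_anti : Antitone μ)
    (x1 : Fin K → ℝ) :
    ∀ᵐ ω ∂P, Tendsto
      (OnlineParallel.iterate (fun τ n => g τ n ω)
        (OnlineParallel.measurement xstar (fun τ n => g τ n ω) (fun τ n => v τ n ω))
        μ (fun s => c s ω) x1)
      atTop (𝓝 xstar) := by
  filter_upwards [OnlineParallel.ae_tendsto_sampleGram hsample_indep hsample_ident (hg_sq 0),
    OnlineParallel.ae_tendsto_sampleCross_noise hsample_indep hsample_ident (hg_sq 0) (hv_sq 0)
      (hv_mean 0) (hgv 0), hc_bdd, hc] with ω hG hnoise ⟨C, hC⟩ ⟨c₀, hc₀, hcω⟩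
  have hb : Tendsto (fun s => OnlineParallel.sampleCross (fun τ n => g τ n ω)
      (OnlineParallel.measurement xstar (fun τ n => g τ n ω) (fun τ n => v τ n ω)) s) atTop
      (𝓝 ((OnlineParallel.momentMatrix P (g 0)).mulVec xstar)) := by
    simp only [OnlineParallel.sampleCross_measurement]
    have hmul : Continuous fun A : Matrix (Fin K) (Fin K) ℝ => A.mulVec xstar := by fun_prop
    simpa only [add_zero, Function.comp_apply] using ((hmul.tendsto _).comp hG).add hnoise
  exact OnlineParallel.tendsto_of_tendsto_data
    (fun s => OnlineParallel.sampleGram_posSemidef (fun τ n => g τ n ω) s)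
    (OnlineParallel.momentMatrix_posDef hN (hg_sq 0) (hg_cov 0)) hG hb (fun s => (hμ_pos s).le)
    hμ_lim hC hc₀ hcω (fun _ => rfl)
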